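/- Let $G$ be a finite simple graph with $m$ edges that is not bipartite, and let $\lambda_1(G)$ denote the largest eigenvalue of its adjacency matrix. If $\lambda_1(G)\ge \sqrt{m-1}$, then $G$ contains a triangle, unless $G$ is isomorphic to the disjoint union of the cycle $C_5$ of length five and $k$ isolated vertices for some integer $k\ge 0$ (in which case $G$ contains no triangle). -/

import Mathlib

namespace SimpleGraph

/-- The largest eigenvalue `λ₁(G)` of the adjacency matrix of a finite simple graph `G`
(the maximum of the finite family of all eigenvalues; the vertex set is meant to be nonempty). -/
noncomputable def lambdaOne {V : Type*} [Fintype V] [DecidableEq V] (G : SimpleGraph V)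
    [DecidableRel G.Adj] : ℝ :=
  ⨆ v : V, (G.isHermitian_adjMatrix ℝ).eigenvalues v

/-- `G` is the disjoint union of a cycle of length five and `k ≥ 0` isolated vertices. -/
def IsFiveCycleWithIsolated {V : Type*} (G : SimpleGraph V) : Prop :=
  ∃ k : ℕ, Nonempty (G ≃g (cycleGraph 5 ⊕g (⊥ : SimpleGraph (Fin k))))

end SimpleGraph

/-! Suppose `G` is triangle-free and not bipartite. A shortest odd closed walk is an induced cycle
of length at least 5, so `G` contains an induced `C₅` or an induced `P₆`. By interlacing, this
forces two eigenvalues at most `-d` and, beyond the largest one `L`, `k` more that are at least `c`.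
The squares of the eigenvalues sum to `2m` and their cubes to 0. These facts bound `L ^ 3` by an
expression in `L` and `m` (`cube_add_le_of_sum_cube_eq_zero`), which contradicts `L ^ 2 ≥ m - 1`
unless `C₅` appears and `m = 5`, the exceptional graph. -/

open Matrix Finset SimpleGraph

/-! ### Counting eigenvalues by quadratic forms. -/

/-- If a quadratic form, diagonal with coefficients `e`, is at least `c` times the sum of squares
on a `k`-dimensional space, then at least `k` of its coefficients are at least `c`. -/
theorem card_le_card_filter_of_injective {V : Type*} [Fintype V] {k : ℕ} (e : V → ℝ) (c : ℝ)
    (f : (Fin k → ℝ) →ₗ[ℝ] (V → ℝ)) (hf : Function.Injective f)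
    (h : ∀ a, c * ∑ i, f a i ^ 2 ≤ ∑ i, e i * f a i ^ 2) :
    k ≤ #{i | c ≤ e i} := by
  classical
  by_contra! hlt
  set S : Finset V := {i | c ≤ e i} with hS
  -- A vector killed by `g` has only coordinates with coefficient below `c`.
  let g : (Fin k → ℝ) →ₗ[ℝ] (S → ℝ) := (LinearMap.funLeft ℝ ℝ (fun i : S => (i : V))) ∘ₗ f
  obtain ⟨a, ha, ha0⟩ : ∃ a, g a = 0 ∧ a ≠ 0 := by
    have hk : LinearMap.ker g ≠ ⊥ := LinearMap.ker_ne_bot_of_finrank_lt (by simpa using hlt)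
    obtain ⟨a, ha, ha0⟩ := (Submodule.ne_bot_iff _).1 hk
    exact ⟨a, ha, ha0⟩
  have hz : ∀ i, c ≤ e i → f a i = 0 := fun i hi =>
    congrFun ha ⟨i, by simpa [hS] using hi⟩
  obtain ⟨i, hi⟩ : ∃ i, f a i ≠ 0 := by
    by_contra! hcon
    exact ha0 (hf (by rw [map_zero]; exact funext hcon))
  refine (h a).not_gt ?_
  rw [Finset.mul_sum]
  refine Finset.sum_lt_sum (fun j _ => ?_) ⟨i, Finset.mem_univ i, ?_⟩
  · by_cases hj : c ≤ e j
    · simp [hz j hj]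
    · exact mul_le_mul_of_nonneg_right (not_le.1 hj).le (sq_nonneg _)
  · have : e i < c := not_le.1 fun hc => hi (hz i hc)
    exact mul_lt_mul_of_pos_right this (by positivity)

namespace Matrix.IsHermitian

variable {V : Type*} [Fintype V] [DecidableEq V] {A : Matrix V V ℝ} (hA : A.IsHermitian)

theorem eq_mul_diagonal_mul :
    A = (hA.eigenvectorUnitary : Matrix V V ℝ) * diagonal hA.eigenvalues *
      (hA.eigenvectorUnitary : Matrix V V ℝ)ᵀ := by
  conv_lhs => rw [hA.spectral_theorem, Unitary.conjStarAlgAut_apply]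
  rfl

theorem transpose_eigenvectorUnitary_mul :
    (hA.eigenvectorUnitary : Matrix V V ℝ)ᵀ * (hA.eigenvectorUnitary : Matrix V V ℝ) = 1 :=
  Unitary.coe_star_mul_self hA.eigenvectorUnitary

theorem eigenvectorUnitary_mul_transpose :
    (hA.eigenvectorUnitary : Matrix V V ℝ) * (hA.eigenvectorUnitary : Matrix V V ℝ)ᵀ = 1 :=
  Unitary.coe_mul_star_self hA.eigenvectorUnitary

theorem sum_eigenvalues_pow_eq_trace (k : ℕ) : ∑ i, hA.eigenvalues i ^ k = (A ^ k).trace := by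
  have h : A ^ k = (hA.eigenvectorUnitary : Matrix V V ℝ) * diagonal hA.eigenvalues ^ k *
      (hA.eigenvectorUnitary : Matrix V V ℝ)ᵀ := by
    induction k with
    | zero => simp [hA.eigenvectorUnitary_mul_transpose]
    | succ k ih =>
      rw [pow_succ, ih]
      refine (congrArg (_ * ·) hA.eq_mul_diagonal_mul).trans ?_
      have := hA.transpose_eigenvectorUnitary_mul
      simp only [Matrix.mul_assoc, pow_succ]
      rw [← Matrix.mul_assoc _ᵀ, this, Matrix.one_mul]
  rw [h, Matrix.trace_mul_comm, ← Matrix.mul_assoc, hA.transpose_eigenvectorUnitary_mul,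
    Matrix.one_mul, diagonal_pow, trace_diagonal]
  simp

theorem dotProduct_self_eq_sum (y : V → ℝ) :
    y ⬝ᵥ y = ∑ i, ((hA.eigenvectorUnitary : Matrix V V ℝ)ᵀ *ᵥ y) i ^ 2 := by
  have : ∑ i, ((hA.eigenvectorUnitary : Matrix V V ℝ)ᵀ *ᵥ y) i ^ 2 =
      ((hA.eigenvectorUnitary : Matrix V V ℝ)ᵀ *ᵥ y) ⬝ᵥ
        ((hA.eigenvectorUnitary : Matrix V V ℝ)ᵀ *ᵥ y) := by
    simp [dotProduct, sq]
  rw [this, dotProduct_mulVec, vecMul_transpose, mulVec_mulVec,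
    hA.eigenvectorUnitary_mul_transpose, one_mulVec]

theorem dotProduct_mulVec_eq_sum (y : V → ℝ) :
    y ⬝ᵥ A *ᵥ y =
      ∑ i, hA.eigenvalues i * ((hA.eigenvectorUnitary : Matrix V V ℝ)ᵀ *ᵥ y) i ^ 2 := by
  have : ∑ i, hA.eigenvalues i * ((hA.eigenvectorUnitary : Matrix V V ℝ)ᵀ *ᵥ y) i ^ 2 =
      ((hA.eigenvectorUnitary : Matrix V V ℝ)ᵀ *ᵥ y) ⬝ᵥ (diagonal hA.eigenvalues *ᵥ
        ((hA.eigenvectorUnitary : Matrix V V ℝ)ᵀ *ᵥ y)) := by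
    simp only [dotProduct, mulVec_diagonal]
    exact Finset.sum_congr rfl fun i _ => by ring
  rw [this]
  conv_lhs => rw [hA.eq_mul_diagonal_mul]
  rw [← mulVec_mulVec, ← mulVec_mulVec, dotProduct_mulVec, ← mulVec_transpose]

theorem injective_transpose_eigenvectorUnitary :
    Function.Injective ((hA.eigenvectorUnitary : Matrix V V ℝ)ᵀ).mulVecLin := by
  intro x y hxy
  have := congrArg ((hA.eigenvectorUnitary : Matrix V V ℝ) *ᵥ ·) hxy
  simpa only [mulVecLin_apply, mulVec_mulVec, hA.eigenvectorUnitary_mul_transpose, one_mulVec]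
    using this

theorem card_le_card_eigenvalues_ge {k : ℕ} {c : ℝ}
    (f : (Fin k → ℝ) →ₗ[ℝ] (V → ℝ)) (hf : Function.Injective f)
    (h : ∀ a, c * (f a ⬝ᵥ f a) ≤ f a ⬝ᵥ A *ᵥ f a) :
    k ≤ #{i | c ≤ hA.eigenvalues i} := by
  refine card_le_card_filter_of_injective _ c
    (((hA.eigenvectorUnitary : Matrix V V ℝ)ᵀ).mulVecLin ∘ₗ f)
    (hA.injective_transpose_eigenvectorUnitary.comp hf) fun a => ?_
  have := h a
  rwa [hA.dotProduct_self_eq_sum, hA.dotProduct_mulVec_eq_sum] at this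

theorem card_le_card_eigenvalues_le {k : ℕ} {c : ℝ}
    (f : (Fin k → ℝ) →ₗ[ℝ] (V → ℝ)) (hf : Function.Injective f)
    (h : ∀ a, f a ⬝ᵥ A *ᵥ f a ≤ c * (f a ⬝ᵥ f a)) :
    k ≤ #{i | hA.eigenvalues i ≤ c} := by
  have key := card_le_card_filter_of_injective (fun i => -hA.eigenvalues i) (-c)
    (((hA.eigenvectorUnitary : Matrix V V ℝ)ᵀ).mulVecLin ∘ₗ f)
    (hA.injective_transpose_eigenvectorUnitary.comp hf) fun a => ?_
  · simpa using key
  · have := h a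
    rw [hA.dotProduct_self_eq_sum, hA.dotProduct_mulVec_eq_sum] at this
    simpa only [LinearMap.comp_apply, mulVecLin_apply, neg_mul, sum_neg_distrib, neg_le_neg_iff]
      using this

end Matrix.IsHermitian

/-! ### Interlacing for induced subgraphs. -/

namespace SimpleGraph

variable {V W : Type*} [Fintype V] [Fintype W] {G : SimpleGraph V} {H : SimpleGraph W}

theorem extendByZero_dotProduct (φ : H ↪g G) (x : W → ℝ) (y : V → ℝ) :
    Function.ExtendByZero.linearMap ℝ φ x ⬝ᵥ y = x ⬝ᵥ (y ∘ φ) := by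
  refine (Fintype.sum_of_injective φ φ.injective _ _ (fun i hi => ?_) fun i => ?_).symm
  · have : Function.extend φ x 0 i = 0 := Function.extend_apply' _ _ _ (by simpa using hi)
    simp [this]
  · simp [φ.injective.extend_apply]

omit [Fintype V] [Fintype W] in
theorem extendByZero_comp (φ : H ↪g G) (x : W → ℝ) :
    Function.ExtendByZero.linearMap ℝ φ x ∘ φ = x := by
  ext i
  simp [φ.injective.extend_apply]

theorem extendByZero_dotProduct_self (φ : H ↪g G) (x : W → ℝ) :
    Function.ExtendByZero.linearMap ℝ φ x ⬝ᵥ Function.ExtendByZero.linearMap ℝ φ x = x ⬝ᵥ x := by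
  rw [extendByZero_dotProduct, extendByZero_comp]

variable [DecidableRel G.Adj] [DecidableRel H.Adj]

theorem extendByZero_dotProduct_mulVec (φ : H ↪g G) (x : W → ℝ) :
    Function.ExtendByZero.linearMap ℝ φ x ⬝ᵥ
      G.adjMatrix ℝ *ᵥ Function.ExtendByZero.linearMap ℝ φ x = x ⬝ᵥ H.adjMatrix ℝ *ᵥ x := by
  rw [extendByZero_dotProduct]
  congr 1
  ext i
  simp only [Function.comp_apply, mulVec]
  rw [dotProduct_comm, extendByZero_dotProduct, dotProduct_comm]
  congr 1
  ext j
  simp [adjMatrix_apply]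

variable [DecidableEq V]

/-- A subspace on which the quadratic form of an induced subgraph is at least `c` times the square
of the norm bounds from below the number of eigenvalues that are at least `c`. -/
theorem card_le_card_eigenvalues_ge (φ : H ↪g G) {k : ℕ} {c : ℝ}
    (f : (Fin k → ℝ) →ₗ[ℝ] (W → ℝ)) (hf : Function.Injective f)
    (h : ∀ a, c * (f a ⬝ᵥ f a) ≤ f a ⬝ᵥ H.adjMatrix ℝ *ᵥ f a) :
    k ≤ #{i | c ≤ (G.isHermitian_adjMatrix ℝ).eigenvalues i} := by
  refine (G.isHermitian_adjMatrix ℝ).card_le_card_eigenvalues_ge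
    (Function.ExtendByZero.linearMap ℝ φ ∘ₗ f)
    ((Function.LeftInverse.injective (g := (· ∘ φ)) (extendByZero_comp φ)).comp hf) fun a => ?_
  simpa only [LinearMap.comp_apply, extendByZero_dotProduct_self,
    extendByZero_dotProduct_mulVec] using h a

theorem card_le_card_eigenvalues_le (φ : H ↪g G) {k : ℕ} {c : ℝ}
    (f : (Fin k → ℝ) →ₗ[ℝ] (W → ℝ)) (hf : Function.Injective f)
    (h : ∀ a, f a ⬝ᵥ H.adjMatrix ℝ *ᵥ f a ≤ c * (f a ⬝ᵥ f a)) :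
    k ≤ #{i | (G.isHermitian_adjMatrix ℝ).eigenvalues i ≤ c} := by
  refine (G.isHermitian_adjMatrix ℝ).card_le_card_eigenvalues_le
    (Function.ExtendByZero.linearMap ℝ φ ∘ₗ f)
    ((Function.LeftInverse.injective (g := (· ∘ φ)) (extendByZero_comp φ)).comp hf) fun a => ?_
  simpa only [LinearMap.comp_apply, extendByZero_dotProduct_self,
    extendByZero_dotProduct_mulVec] using h a

end SimpleGraph

/-! ### Cubic inequalities. -/

/-- Among nonnegative reals with `p ^ 2 + q ^ 2 = P ^ 2 + d ^ 2` and `d ≤ q ≤ p`, the sum of cubes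
is largest for the pair `(P, d)`. -/
theorem cube_add_cube_le_of_sq_add_sq_eq {p q P d : ℝ} (hd : 0 ≤ d) (hdq : d ≤ q) (hqp : q ≤ p)
    (hpP : p ≤ P) (h : p ^ 2 + q ^ 2 = P ^ 2 + d ^ 2) : p ^ 3 + q ^ 3 ≤ P ^ 3 + d ^ 3 := by
  have h1 : 3 * p * (P ^ 2 - p ^ 2) ≤ 2 * (P ^ 3 - p ^ 3) := by
    have : 0 ≤ (P - p) ^ 2 * (2 * P + p) := by
      have : 0 ≤ p := by linarith
      have : 0 ≤ P := by linarith
      positivity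
    nlinarith
  have h2 : 2 * (q ^ 3 - d ^ 3) ≤ 3 * q * (q ^ 2 - d ^ 2) := by
    have : 0 ≤ (q - d) ^ 2 * (q + 2 * d) := by
      have : 0 ≤ q := by linarith
      positivity
    nlinarith
  have h3 : 3 * q * (q ^ 2 - d ^ 2) ≤ 3 * p * (P ^ 2 - p ^ 2) := by
    have : P ^ 2 - p ^ 2 = q ^ 2 - d ^ 2 := by linarith
    rw [this]
    have : 0 ≤ q ^ 2 - d ^ 2 := by nlinarith
    nlinarith
  linarith

/-- The left side increases with `p` for `p ≥ q`, so `p` may be raised to `r` with `r ^ 2 + q ^ 2 =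
T`. The pair `(r, q)` is then spread out to `(P, d)`. -/
theorem cube_add_mul_le {p q T d P : ℝ} (hd : 0 ≤ d) (hdq : d ≤ q) (hqp : q ≤ p)
    (hT : p ^ 2 + q ^ 2 ≤ T) (hP : 0 ≤ P) (hPT : P ^ 2 = T - d ^ 2) :
    p ^ 3 + q * (T - p ^ 2) ≤ P ^ 3 + d ^ 3 := by
  have hq0 : 0 ≤ q := hd.trans hdq
  have hr : Real.sqrt (T - q ^ 2) ^ 2 = T - q ^ 2 := Real.sq_sqrt (by nlinarith)
  set r := Real.sqrt (T - q ^ 2)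
  have hr0 : 0 ≤ r := Real.sqrt_nonneg _
  have hpr : p ≤ r := by
    refine (sq_le_sq₀ (by linarith) hr0).1 ?_
    linarith
  have hrP : r ≤ P := by
    refine (sq_le_sq₀ hr0 hP).1 ?_
    nlinarith
  refine le_trans ?_ (cube_add_cube_le_of_sq_add_sq_eq hd hdq (hqp.trans hpr) hrP (by linarith))
  have : T = r ^ 2 + q ^ 2 := by linarith
  rw [this]
  have : 0 ≤ (r - p) * (r ^ 2 + r * p + p ^ 2 - q * (r + p)) := by
    refine mul_nonneg (by linarith) ?_
    nlinarith
  nlinarith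

/-- A cubic inequality for a finite family of reals whose cubes sum to zero, given a largest
member, a set of further members at least `c`, and two members at most `-d`. -/
theorem cube_add_le_of_sum_cube_eq_zero {V : Type*} [Fintype V] [DecidableEq V] (e : V → ℝ)
    {c d M : ℝ} {k : ℕ} (hc : 0 ≤ c) (hd : 0 < d) (i₀ : V) (hmax : ∀ i, e i ≤ e i₀)
    (hpos : k + 1 ≤ #{i | c ≤ e i}) (hneg : 2 ≤ #{i | e i ≤ -d})
    (h2 : ∑ i, e i ^ 2 = M) (h3 : ∑ i, e i ^ 3 = 0) :
    ∃ P, 0 ≤ P ∧ P ^ 2 = M - e i₀ ^ 2 - k * c ^ 2 - d ^ 2 ∧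
      e i₀ ^ 3 + k * c ^ 3 ≤ P ^ 3 + d ^ 3 := by
  have hcL : c ≤ e i₀ := by
    obtain ⟨i, hi⟩ := card_pos.1 (Nat.lt_of_lt_of_le k.succ_pos hpos)
    exact (mem_filter.1 hi).2.trans (hmax i)
  obtain ⟨j₀, -, hj₀⟩ := exists_min_image univ e ⟨i₀, mem_univ _⟩
  obtain ⟨j', hj'⟩ : (({i | e i ≤ -d} : Finset V).erase j₀).Nonempty := by
    rw [← card_pos]
    have := pred_card_le_card_erase (s := ({i | e i ≤ -d} : Finset V)) (a := j₀)
    omega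
  simp only [mem_erase, mem_filter, mem_univ, true_and] at hj'
  obtain ⟨j₁, hj₁mem, hj₁⟩ := exists_min_image (univ.erase j₀) e ⟨j', by simp [hj'.1]⟩
  have hj₁d : e j₁ ≤ -d := (hj₁ j' (by simp [hj'.1])).trans hj'.2
  have hj₀₁ : e j₀ ≤ e j₁ := hj₀ j₁ (mem_univ _)
  have hne : j₁ ≠ j₀ := ne_of_mem_erase hj₁mem
  -- `-p` and `-q` are the smallest and second smallest members.
  set q := -e j₁ with hq
  set p := -e j₀ with hp
  obtain ⟨S, hS, hSk⟩ : ∃ S ⊆ ({i | c ≤ e i} : Finset V).erase i₀, #S = k := by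
    refine exists_subset_card_eq ?_
    rw [card_erase_of_mem (by simpa using hcL)]
    omega
  have hSc : ∀ i ∈ S, i ≠ i₀ ∧ c ≤ e i := fun i hi => by simpa using hS hi
  have hiS : i₀ ∉ S := fun h => (hSc i₀ h).1 rfl
  have hjS : ∀ j, e j ≤ -d → j ∉ insert i₀ S := by
    intro j hj h
    rcases mem_insert.1 h with rfl | h
    · linarith
    · linarith [(hSc j h).2]
  have hj₀S : j₀ ∉ insert i₀ S := hjS j₀ (hj₀₁.trans hj₁d)
  have hsplit : ∀ g : V → ℝ, ∑ i, g i =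
      g j₀ + (g i₀ + ∑ i ∈ S, g i) + ∑ i ∈ (insert j₀ (insert i₀ S))ᶜ, g i := by
    intro g
    rw [← sum_add_sum_compl (insert j₀ (insert i₀ S)) g, sum_insert hj₀S, sum_insert hiS]
  have hS2 : k * c ^ 2 ≤ ∑ i ∈ S, e i ^ 2 := by
    rw [← hSk, ← nsmul_eq_mul]
    exact card_nsmul_le_sum _ _ _ fun i hi => pow_le_pow_left₀ hc (hSc i hi).2 2
  have hS3 : k * c ^ 3 ≤ ∑ i ∈ S, e i ^ 3 := by
    rw [← hSk, ← nsmul_eq_mul]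
    exact card_nsmul_le_sum _ _ _ fun i hi => pow_le_pow_left₀ hc (hSc i hi).2 3
  -- Every member other than `e j₀` is at least `-q`, so its cube is at least `-q` times its square.
  have hrest : 0 ≤ ∑ i ∈ (insert j₀ (insert i₀ S))ᶜ, (e i ^ 3 + q * e i ^ 2) := by
    refine sum_nonneg fun i hi => ?_
    have hi₀ : i ≠ j₀ := by
      rintro rfl
      simp at hi
    have : 0 ≤ e i + q := by linarith [hj₁ i (by simp [hi₀])]
    nlinarith [mul_nonneg (sq_nonneg (e i)) this]
  have hj₁rest : e j₁ ^ 2 ≤ ∑ i ∈ (insert j₀ (insert i₀ S))ᶜ, e i ^ 2 := by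
    refine single_le_sum (f := fun i => e i ^ 2) (fun i _ => sq_nonneg _) ?_
    rw [mem_compl, mem_insert, not_or]
    exact ⟨hne, hjS j₁ hj₁d⟩
  rw [sum_add_distrib, ← mul_sum] at hrest
  rw [hsplit] at h2 h3
  have hp2 : p ^ 2 = e j₀ ^ 2 := by rw [hp]; ring
  have hp3 : p ^ 3 = -e j₀ ^ 3 := by rw [hp]; ring
  have hq2 : q ^ 2 = e j₁ ^ 2 := by rw [hq]; ring
  have hdq : d ≤ q := by linarith
  have hPM : Real.sqrt (M - e i₀ ^ 2 - k * c ^ 2 - d ^ 2) ^ 2 =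
      M - e i₀ ^ 2 - k * c ^ 2 - d ^ 2 := Real.sq_sqrt (by nlinarith [sq_nonneg p])
  refine ⟨_, Real.sqrt_nonneg _, hPM, ?_⟩
  have key := cube_add_mul_le (p := p) (q := q) (T := M - e i₀ ^ 2 - k * c ^ 2) hd.le
    hdq (by linarith) (by linarith) (Real.sqrt_nonneg _) hPM
  refine le_trans ?_ key
  have : q * ∑ i ∈ (insert j₀ (insert i₀ S))ᶜ, e i ^ 2 ≤
      q * (M - e i₀ ^ 2 - k * c ^ 2 - p ^ 2) :=
    mul_le_mul_of_nonneg_left (by linarith) (hd.le.trans hdq)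
  linarith

/-! ### Power sums of the adjacency eigenvalues. -/

namespace SimpleGraph

section Spectrum

variable {V : Type*} [Fintype V] [DecidableEq V] (G : SimpleGraph V) [DecidableRel G.Adj]

theorem sum_eigenvalues_sq :
    ∑ i, (G.isHermitian_adjMatrix ℝ).eigenvalues i ^ 2 = 2 * (#G.edgeFinset : ℝ) := by
  rw [IsHermitian.sum_eigenvalues_pow_eq_trace, pow_two]
  simp only [Matrix.trace, diag_apply, adjMatrix_mul_self_apply_self]
  exact_mod_cast G.sum_degrees_eq_twice_card_edges

variable {G}

theorem sum_eigenvalues_cube_eq_zero (h : ¬ ∃ a b c : V, G.Adj a b ∧ G.Adj b c ∧ G.Adj a c) :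
    ∑ i, (G.isHermitian_adjMatrix ℝ).eigenvalues i ^ 3 = 0 := by
  rw [IsHermitian.sum_eigenvalues_pow_eq_trace, pow_succ', pow_two]
  refine Finset.sum_eq_zero fun i _ => ?_
  simp only [diag_apply, adjMatrix_mul_apply]
  refine Finset.sum_eq_zero fun j hj => Finset.sum_eq_zero fun l hl => ?_
  rw [mem_neighborFinset] at hj hl
  rw [adjMatrix_apply, if_neg fun hli => h ⟨i, j, l, hj, hl, hli.symm⟩]

theorem exists_eigenvalues_eq_lambdaOne [Nonempty V] :
    ∃ i₀, (G.isHermitian_adjMatrix ℝ).eigenvalues i₀ = G.lambdaOne ∧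
      ∀ i, (G.isHermitian_adjMatrix ℝ).eigenvalues i ≤
        (G.isHermitian_adjMatrix ℝ).eigenvalues i₀ := by
  obtain ⟨i₀, hi₀⟩ := exists_eq_ciSup_of_finite (f := (G.isHermitian_adjMatrix ℝ).eigenvalues)
  refine ⟨i₀, hi₀, fun i => ?_⟩
  rw [hi₀]
  exact le_ciSup (Set.finite_range _).bddAbove i

theorem exists_lambdaOne_cube_add_le [Nonempty V]
    (h : ¬ ∃ a b c : V, G.Adj a b ∧ G.Adj b c ∧ G.Adj a c) {c d : ℝ} {k : ℕ} (hc : 0 ≤ c)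
    (hd : 0 < d) (hpos : k + 1 ≤ #{i | c ≤ (G.isHermitian_adjMatrix ℝ).eigenvalues i})
    (hneg : 2 ≤ #{i | (G.isHermitian_adjMatrix ℝ).eigenvalues i ≤ -d}) :
    ∃ P, 0 ≤ P ∧ P ^ 2 = 2 * (#G.edgeFinset : ℝ) - G.lambdaOne ^ 2 - k * c ^ 2 - d ^ 2 ∧
      G.lambdaOne ^ 3 + k * c ^ 3 ≤ P ^ 3 + d ^ 3 := by
  obtain ⟨i₀, hi₀, hmax⟩ := G.exists_eigenvalues_eq_lambdaOne
  rw [← hi₀]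
  exact cube_add_le_of_sum_cube_eq_zero _ hc hd i₀ hmax hpos hneg G.sum_eigenvalues_sq
    (sum_eigenvalues_cube_eq_zero h)

end Spectrum

/-! ### Trial vectors on `C₅` and `P₆`. -/

section Trial

instance (n : ℕ) : DecidableRel (pathGraph n).Adj :=
  fun _ _ => decidable_of_iff _ pathGraph_adj.symm

variable {V : Type*} [Fintype V] [DecidableEq V] {G : SimpleGraph V} [DecidableRel G.Adj]

theorem mulVecLin_injective_of_forall {m n : ℕ} (M : Matrix (Fin m) (Fin n) ℝ)
    (h : ∀ a, M *ᵥ a = 0 → a = 0) : Function.Injective M.mulVecLin :=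
  (injective_iff_map_eq_zero _).2 h

theorem dotProduct_mulVec_adjMatrix_cycleGraph_five (x : Fin 5 → ℝ) :
    x ⬝ᵥ (cycleGraph 5).adjMatrix ℝ *ᵥ x =
      2 * (x 0 * x 1 + x 1 * x 2 + x 2 * x 3 + x 3 * x 4 + x 4 * x 0) := by
  rw [dotProduct_mulVec_adjMatrix]
  simp +decide only [Fin.sum_univ_five, if_true, if_false]
  ring

theorem three_le_card_eigenvalues_of_cycleGraph_five (φ : cycleGraph 5 ↪g G) :
    3 ≤ #{i | (3 / 5 : ℝ) ≤ (G.isHermitian_adjMatrix ℝ).eigenvalues i} := by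
  refine card_le_card_eigenvalues_ge φ
    -- Constants, and rounded multiples of `cos (2πj/5)` and `sin (2πj/5)`: eigenvalues 2 and
    -- 0.618….
    (!![1, 10, 0; 1, 3, 8; 1, -8, 5; 1, -8, -5; 1, 3, -8] : Matrix _ _ ℝ).mulVecLin
    (mulVecLin_injective_of_forall _ fun a ha => ?_) fun a => ?_
  · have h0 := congrFun ha 0
    have h1 := congrFun ha 1
    have h2 := congrFun ha 2
    have h4 := congrFun ha 4
    simp [mulVec, dotProduct, Fin.sum_univ_succ] at h0 h1 h2 h4
    ext i
    fin_cases i <;> simp <;> linarith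
  · rw [dotProduct_mulVec_adjMatrix_cycleGraph_five]
    simp [mulVec, dotProduct, Fin.sum_univ_succ]
    nlinarith [sq_nonneg (a 0), sq_nonneg (a 1), sq_nonneg (a 2)]

theorem two_le_card_eigenvalues_of_cycleGraph_five (φ : cycleGraph 5 ↪g G) :
    2 ≤ #{i | (G.isHermitian_adjMatrix ℝ).eigenvalues i ≤ -(8 / 5 : ℝ)} := by
  refine card_le_card_eigenvalues_le φ
    -- Rounded multiples of `cos (4πj/5)` and `sin (4πj/5)`, with eigenvalue -1.618….
    (!![10, 0; -8, 5; 3, -8; 3, 8; -8, -5] : Matrix _ _ ℝ).mulVecLin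
    (mulVecLin_injective_of_forall _ fun a ha => ?_) fun a => ?_
  · have h0 := congrFun ha 0
    have h1 := congrFun ha 1
    simp [mulVec, dotProduct, Fin.sum_univ_succ] at h0 h1
    ext i
    fin_cases i <;> simp <;> linarith
  · rw [dotProduct_mulVec_adjMatrix_cycleGraph_five]
    simp [mulVec, dotProduct, Fin.sum_univ_succ]
    nlinarith [sq_nonneg (a 0), sq_nonneg (a 1)]

theorem two_le_card_eigenvalues_ge_of_pathGraph_six (φ : pathGraph 6 ↪g G) :
    2 ≤ #{i | (11 / 9 : ℝ) ≤ (G.isHermitian_adjMatrix ℝ).eigenvalues i} := by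
  refine card_le_card_eigenvalues_ge φ
    -- Each half `(2, 2, 1)` has form 12 and squared norm 9. The middle edge adds `2 * a 0 * a 1`,
    -- which costs at most 1, leaving `11 / 9`.
    (!![2, 0; 2, 0; 1, 0; 0, 1; 0, 2; 0, 2] : Matrix _ _ ℝ).mulVecLin
    (mulVecLin_injective_of_forall _ fun a ha => ?_) fun a => ?_
  · have h0 := congrFun ha 2
    have h1 := congrFun ha 3
    simp [mulVec, dotProduct, Fin.sum_univ_succ] at h0 h1
    ext i
    fin_cases i <;> simp <;> linarith
  · rw [dotProduct_mulVec_adjMatrix]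
    simp [mulVec, dotProduct, Fin.sum_univ_succ, pathGraph_adj]
    nlinarith [sq_nonneg (a 0 + a 1), sq_nonneg (a 0 - a 1)]

theorem two_le_card_eigenvalues_le_of_pathGraph_six (φ : pathGraph 6 ↪g G) :
    2 ≤ #{i | (G.isHermitian_adjMatrix ℝ).eigenvalues i ≤ -(11 / 9 : ℝ)} := by
  refine card_le_card_eigenvalues_le φ
    (!![2, 0; -2, 0; 1, 0; 0, 1; 0, -2; 0, 2] : Matrix _ _ ℝ).mulVecLin
    (mulVecLin_injective_of_forall _ fun a ha => ?_) fun a => ?_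
  · have h0 := congrFun ha 2
    have h1 := congrFun ha 3
    simp [mulVec, dotProduct, Fin.sum_univ_succ] at h0 h1
    ext i
    fin_cases i <;> simp <;> linarith
  · rw [dotProduct_mulVec_adjMatrix]
    simp [mulVec, dotProduct, Fin.sum_univ_succ, pathGraph_adj]
    nlinarith [sq_nonneg (a 0 + a 1), sq_nonneg (a 0 - a 1)]

end Trial

end SimpleGraph

/-! ### Shortest odd closed walks. -/

namespace SimpleGraph

namespace Walk

variable {V : Type*} {G : SimpleGraph V} {u : V} (w : G.Walk u u)

/-- Positions `i` and `j` cut `w` into two arcs, and `q` closes up each of them. -/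
theorem odd_length_le_of_detour (hmin : ∀ x (p : G.Walk x x), Odd p.length → w.length ≤ p.length)
    {i j : ℕ} (hij : i ≤ j) (hj : j ≤ w.length) (q : G.Walk (w.getVert j) (w.getVert i)) :
    (Odd (j - i + q.length) → w.length ≤ j - i + q.length) ∧
      (Odd (w.length - j + i + q.length) → w.length ≤ w.length - j + i + q.length) := by
  constructor
  · have hget : (w.drop i).getVert (j - i) = w.getVert j := by
      rw [drop_getVert]; congr 1; omega
    have := hmin _ ((((w.drop i).take (j - i)).copy rfl hget).append q)
    have hlen : min (j - i) (w.length - i) = j - i := by omega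
    simpa [hlen] using this
  · have := hmin _ (((w.drop j).append (w.take i)).append q.reverse)
    have hlen : min i w.length = i := by omega
    simpa [hlen] using this

variable (hodd : Odd w.length) (hmin : ∀ x (p : G.Walk x x), Odd p.length → w.length ≤ p.length)

include hodd hmin

theorem getVert_ne_of_odd_minimal {i j : ℕ} (hij : i < j) (hj : j < w.length) :
    w.getVert i ≠ w.getVert j := by
  intro h
  obtain ⟨h1, h2⟩ := w.odd_length_le_of_detour hmin hij.le hj.le (Walk.nil.copy rfl h.symm)
  simp only [length_copy, length_nil, Nat.odd_iff] at h1 h2 hodd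
  omega

theorem adj_getVert_iff_of_odd_minimal {i j : ℕ} (hij : i < j) (hj : j < w.length) :
    G.Adj (w.getVert i) (w.getVert j) ↔ j = i + 1 ∨ (i = 0 ∧ j + 1 = w.length) := by
  constructor
  · intro h
    obtain ⟨h1, h2⟩ := w.odd_length_le_of_detour hmin hij.le hj.le h.symm.toWalk
    simp only [length_cons, length_nil, Nat.odd_iff] at h1 h2 hodd
    omega
  · rintro (rfl | ⟨rfl, h⟩)
    · exact w.adj_getVert_succ (by omega)
    · have := w.adj_getVert_succ hj
      rw [h, w.getVert_length] at this
      simpa using this.symm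

/-- With `n = w.length` this gives a cycle. For smaller `n` the closing edge never occurs, which
leaves a path. -/
theorem nonempty_embedding_of_odd_minimal {n : ℕ} (hn : n ≤ w.length) (H : SimpleGraph (Fin n))
    (hH : ∀ i j : Fin n, i < j →
      (H.Adj i j ↔ (j : ℕ) = i + 1 ∨ ((i : ℕ) = 0 ∧ (j : ℕ) + 1 = w.length))) :
    Nonempty (H ↪g G) := by
  have hadj : ∀ i j : Fin n, i < j → (G.Adj (w.getVert i) (w.getVert j) ↔ H.Adj i j) :=
    fun i j hij => (w.adj_getVert_iff_of_odd_minimal hodd hmin hij (j.2.trans_le hn)).trans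
      (hH i j hij).symm
  refine ⟨⟨⟨fun i => w.getVert i, fun i j hij => ?_⟩, fun {i j} => ?_⟩⟩
  · rcases lt_trichotomy i j with h | h | h
    · exact absurd hij (w.getVert_ne_of_odd_minimal hodd hmin h (j.2.trans_le hn))
    · exact h
    · exact absurd hij.symm (w.getVert_ne_of_odd_minimal hodd hmin h (i.2.trans_le hn))
  · rcases lt_trichotomy i j with h | rfl | h
    · exact hadj i j h
    · simp
    · rw [G.adj_comm, H.adj_comm]
      exact hadj j i h

end Walk

variable {V : Type*} {G : SimpleGraph V}

theorem nonempty_cycleGraph_five_or_pathGraph_six (hG : ¬ G.IsBipartite)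
    (h : ¬ ∃ a b c : V, G.Adj a b ∧ G.Adj b c ∧ G.Adj a c) :
    Nonempty (cycleGraph 5 ↪g G) ∨ Nonempty (pathGraph 6 ↪g G) := by
  have hex : ∃ n, ∃ (u : V) (w : G.Walk u u), Odd w.length ∧ w.length = n := by
    by_contra! hcon
    refine hG (two_colorable_iff_forall_loop_even.2 fun u w => ?_)
    by_contra hw
    exact hcon _ u w (Nat.not_even_iff_odd.1 hw) rfl
  classical
  obtain ⟨u, w, hodd, hw⟩ := Nat.find_spec hex
  have hmin : ∀ x (p : G.Walk x x), Odd p.length → w.length ≤ p.length := fun x p hp => by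
    rw [hw]
    exact Nat.find_min' hex ⟨x, p, hp, rfl⟩
  have h1 : w.length ≠ 1 := by
    intro h1
    have := w.adj_getVert_succ (i := 0) (by omega)
    have h' := w.getVert_length
    rw [h1] at h'
    simp [h'] at this
  have h3 : w.length ≠ 3 := by
    intro h3
    have h02 := (w.adj_getVert_iff_of_odd_minimal hodd hmin (i := 0) (j := 2) (by omega)
      (by omega)).2 (by omega)
    exact h ⟨_, _, _, w.adj_getVert_succ (i := 0) (by omega), w.adj_getVert_succ (by omega), h02⟩
  by_cases h5 : w.length = 5
  · left
    refine w.nonempty_embedding_of_odd_minimal hodd hmin h5.ge _ ?_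
    rw [h5]
    decide
  · right
    have h7 : 7 ≤ w.length := by
      rw [Nat.odd_iff] at hodd
      omega
    refine w.nonempty_embedding_of_odd_minimal hodd hmin (by omega) _ fun i j hij => ?_
    rw [pathGraph_adj]
    omega

theorem not_triangle_of_isFiveCycleWithIsolated (hG : G.IsFiveCycleWithIsolated) :
    ¬ ∃ a b c : V, G.Adj a b ∧ G.Adj b c ∧ G.Adj a c := by
  obtain ⟨k, ⟨e⟩⟩ := hG
  rintro ⟨a, b, c, hab, hbc, hac⟩
  have h5 : ∀ a b c : Fin 5, (cycleGraph 5).Adj a b → (cycleGraph 5).Adj b c →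
    ¬ (cycleGraph 5).Adj a c := by decide
  rw [← e.map_adj_iff] at hab hbc hac
  generalize e a = a' at *
  generalize e b = b' at *
  generalize e c = c' at *
  rcases a' with a' | a' <;> rcases b' with b' | b' <;> rcases c' with c' | c' <;>
    simp at hab hbc hac
  exact h5 _ _ _ hab hbc hac

/-! ### The exceptional case of five edges. -/

section Card

variable [Fintype V] [DecidableRel G.Adj]

theorem map_edgeFinset_subset (φ : cycleGraph 5 ↪g G) :
    (cycleGraph 5).edgeFinset.map φ.toEmbedding.sym2Map ⊆ G.edgeFinset := by
  intro e he
  obtain ⟨e', he', rfl⟩ := mem_map.1 he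
  induction e' with
  | _ x y =>
    rw [mem_edgeFinset, mem_edgeSet] at he'
    exact mem_edgeFinset.2 (φ.map_adj_iff.2 he')

theorem card_edgeFinset_cycleGraph_five : #(cycleGraph 5).edgeFinset = 5 := by decide

theorem isFiveCycleWithIsolated_of_card_edgeFinset (φ : cycleGraph 5 ↪g G)
    (hm : #G.edgeFinset ≤ 5) :
    G.IsFiveCycleWithIsolated := by
  classical
  have heq := eq_of_subset_of_card_le (map_edgeFinset_subset φ)
    (by rwa [card_map, card_edgeFinset_cycleGraph_five])
  have hrange : ∀ x y, G.Adj x y → x ∈ Set.range φ := by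
    intro x y hxy
    have : s(x, y) ∈ G.edgeFinset := by simpa using hxy
    rw [← heq] at this
    obtain ⟨e, -, he⟩ := mem_map.1 this
    induction e with
    | _ a b =>
      have : x ∈ s(φ a, φ b) := by
        have h' : s(φ a, φ b) = s(x, y) := he
        rw [h']
        simp
      rcases Sym2.mem_iff.1 this with rfl | rfl
      · exact ⟨a, rfl⟩
      · exact ⟨b, rfl⟩
  let e : Fin 5 ⊕ Fin (Fintype.card ↥(Set.range φ)ᶜ) ≃ V :=
    (Equiv.sumCongr (Equiv.ofInjective φ φ.injective) (Fintype.equivFin _).symm).trans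
      (Equiv.Set.sumCompl (Set.range φ))
  have hl : ∀ i, e (Sum.inl i) = φ i := fun i => rfl
  have hr : ∀ i, e (Sum.inr i) ∉ Set.range φ := fun i =>
    ((Fintype.equivFin ↥(Set.range φ)ᶜ).symm i).2
  refine ⟨_, ⟨Iso.symm ⟨e, fun {a b} => ?_⟩⟩⟩
  rcases a with a | a <;> rcases b with b | b
  · simp [hl]
  · simpa using fun h => hr b (hrange _ _ h.symm)
  · simpa using fun h => hr a (hrange _ _ h)
  · simpa using fun h => hr a (hrange _ _ h)

end Card

end SimpleGraph

/-! ### Conclusion. -/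

theorem mainTheorem2 {V : Type*} [Fintype V] [DecidableEq V] (G : SimpleGraph V)
    [DecidableRel G.Adj] (hG : ¬ G.IsBipartite)
    (hlam : Real.sqrt ((G.edgeFinset.card : ℝ) - 1) ≤ G.lambdaOne) :
    (∃ a b c : V, G.Adj a b ∧ G.Adj b c ∧ G.Adj a c) ↔ ¬ G.IsFiveCycleWithIsolated := by
  refine ⟨fun h hiso => not_triangle_of_isFiveCycleWithIsolated hiso h, fun hiso => ?_⟩
  by_contra htri
  have hL0 : 0 ≤ G.lambdaOne := (Real.sqrt_nonneg _).trans hlam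
  have hL : (#G.edgeFinset : ℝ) - 1 ≤ G.lambdaOne ^ 2 := (Real.sqrt_le_left hL0).1 hlam
  rcases nonempty_cycleGraph_five_or_pathGraph_six hG htri with ⟨⟨φ⟩⟩ | ⟨⟨φ⟩⟩
  · have : Nonempty V := ⟨φ 0⟩
    have hm : (6 : ℝ) ≤ #G.edgeFinset := by
      by_contra! hm
      have : #G.edgeFinset < 6 := by exact_mod_cast hm
      exact hiso (isFiveCycleWithIsolated_of_card_edgeFinset φ (by omega))
    obtain ⟨P, hP, hP2, hP3⟩ := exists_lambdaOne_cube_add_le htri (k := 2) (by norm_num)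
      (by norm_num) (three_le_card_eigenvalues_of_cycleGraph_five φ)
      (two_le_card_eigenvalues_of_cycleGraph_five φ)
    generalize G.lambdaOne = L at *
    -- Since `2 - 2 * (3/5) ^ 2 - (8/5) ^ 2 = -32/25`, `Q` bounds `P`. The cubic bound gives `L ^ 3
    -- - Q ^ 3 ≤ 458/125 = 3.664`, while `Q ≥ 48/25` will force at least 3.6864.
    have hQ2 : Real.sqrt (L ^ 2 - 32 / 25) ^ 2 = L ^ 2 - 32 / 25 :=
      Real.sq_sqrt (by linarith)
    have hQ0 := Real.sqrt_nonneg (L ^ 2 - 32 / 25)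
    generalize Real.sqrt (L ^ 2 - 32 / 25) = Q at *
    push_cast at hP2 hP3
    have hPQ : P ≤ Q := (sq_le_sq₀ hP hQ0).1 (by linarith)
    have hPQ3 : P ^ 3 ≤ Q ^ 3 := pow_le_pow_left₀ hP hPQ 3
    have hQ : 48 / 25 ≤ Q := by nlinarith
    have hLQ : 3 * Q * (L ^ 2 - Q ^ 2) ≤ 2 * (L ^ 3 - Q ^ 3) := by
      have : 0 ≤ (L - Q) ^ 2 * (2 * L + Q) := by positivity
      nlinarith
    have : L ^ 2 - Q ^ 2 = 32 / 25 := by linarith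
    rw [this] at hLQ
    linarith
  · have : Nonempty V := ⟨φ 0⟩
    obtain ⟨P, hP, hP2, hP3⟩ := exists_lambdaOne_cube_add_le htri (k := 1) (by norm_num)
      (by norm_num) (two_le_card_eigenvalues_ge_of_pathGraph_six φ)
      (two_le_card_eigenvalues_le_of_pathGraph_six φ)
    push_cast at hP2 hP3
    -- Here `c = d = 11/9`: the cubes cancel, and `2 * (11/9) ^ 2 > 2` makes `P` smaller than `λ₁`.
    have hPL : P < G.lambdaOne := (sq_lt_sq₀ hP hL0).1 (by linarith)
    have := pow_lt_pow_left₀ hPL hP three_ne_zero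
    linarith
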